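/- Let $M$ be a nondegenerate symmetric complex $5\times 5$ matrix and let $\mathfrak{so}_5(\mathbf{C})$ be the Lie algebra of complex $5\times5$ matrices $A$ with $A^tM=-MA$. Choose a Cartan subalgebra $\mathfrak h$ and simple roots $\alpha_1,\alpha_2\in\mathfrak h^*$, numbered so that $\alpha_2$ is the long root, and let $\omega_1,\omega_2\in\mathfrak h^*$ be the corresponding fundamental weights. Let $\lambda=\lambda_1\omega_1+\lambda_2\omega_2$ with integers $\lambda_1,\lambda_2\ge 0$ be a dominant weight, let $V(\lambda)$ be the irreducible $\mathfrak{so}_5(\mathbf{C})$-module of highest weight $\lambda$, and for $\mu\in\mathfrak h^*$ let $V(\lambda)_\mu$ be the space of vectors of weight $\mu$ in $V(\lambda)$. Then: - $\dim V(\lambda)_{\lambda-\alpha_1}=1$ if $\lambda_1\ge 1$; - $\dim V(\lambda)_{\lambda-\alpha_2}=1$ if $\lambda_2\ge 1$; - $\dim V(\lambda)_{\lambda-\alpha_1-\alpha_2}=2$ if $\lambda_1,\lambda_2\ge 1$; - $\dim V(\lambda)_{\lambda-2\alpha_1-\alpha_2}=3$ if $\lambda_1\ge 2$ and $\lambda_2\ge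 1$. -/

import Mathlib

attribute [local instance 100] LieRing.ofAssociativeRing

/-- `M` is the matrix of a nondegenerate symmetric bilinear form on `ℂ⁵`. -/
class IsNondegenerateSymmetric (M : Matrix (Fin 5) (Fin 5) ℂ) : Prop where
  isSymm : M.IsSymm
  det_ne_zero : M.det ≠ 0

/-- The Lie algebra `𝔰𝔬₅(ℂ)` of the form with matrix `M`: all complex `5 × 5` matrices `A` with
`Aᵀ * M = -(M * A)`, with the commutator bracket. -/
abbrev so5 (M : Matrix (Fin 5) (Fin 5) ℂ) : LieSubalgebra ℂ (Matrix (Fin 5) (Fin 5) ℂ) :=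
  skewAdjointMatricesLieSubalgebra M

theorem mem_so5_iff (M A : Matrix (Fin 5) (Fin 5) ℂ) : A ∈ so5 M ↔ A.transpose * M = -(M * A) := by
  rw [mem_skewAdjointMatricesLieSubalgebra, mem_skewAdjointMatricesSubmodule]
  simp [Matrix.IsSkewAdjoint, Matrix.IsAdjointPair]

theorem so5_trace_eq_zero (M : Matrix (Fin 5) (Fin 5) ℂ) [IsNondegenerateSymmetric M]
    (A : so5 M) : (A : Matrix (Fin 5) (Fin 5) ℂ).trace = 0 := by
  have hu : IsUnit M.det := (IsNondegenerateSymmetric.det_ne_zero (M := M)).isUnit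
  have h := (mem_so5_iff M A).1 A.2
  have h2 : (A : Matrix (Fin 5) (Fin 5) ℂ).transpose
      = -(M * (A : Matrix (Fin 5) (Fin 5) ℂ) * M⁻¹) := by
    calc _ = (A : Matrix (Fin 5) (Fin 5) ℂ).transpose * M * M⁻¹ := by
            rw [Matrix.mul_assoc, Matrix.mul_nonsing_inv _ hu, Matrix.mul_one]
      _ = _ := by rw [h, Matrix.neg_mul]
  have h3 : (A : Matrix (Fin 5) (Fin 5) ℂ).trace = -(A : Matrix (Fin 5) (Fin 5) ℂ).trace := by
    conv_lhs => rw [← Matrix.trace_transpose, h2, Matrix.trace_neg, Matrix.trace_mul_comm,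
      ← Matrix.mul_assoc, Matrix.nonsing_inv_mul _ hu, Matrix.one_mul]
  exact self_eq_neg.1 h3

/-- The natural representation of `𝔰𝔬₅(ℂ)` on `ℂ⁵` is irreducible. -/
theorem so5_isIrreducible (M : Matrix (Fin 5) (Fin 5) ℂ) [IsNondegenerateSymmetric M] :
    LieModule.IsIrreducible ℂ (so5 M) (Fin 5 → ℂ) := by
  have hs : M.transpose = M := IsNondegenerateSymmetric.isSymm
  have hdet : M.det ≠ 0 := IsNondegenerateSymmetric.det_ne_zero
  have hu : IsUnit M.det := hdet.isUnit
  apply LieModule.IsIrreducible.mk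
  intro N hN
  have key : ∀ v ∈ N, v ≠ 0 → ∀ x, dotProduct (M.mulVec v) x = 0 → x ∈ N := by
    intro v hv hv0 x hx
    have hMv : M.mulVec v ≠ 0 := fun h => hv0 (Matrix.eq_zero_of_mulVec_eq_zero hdet h)
    obtain ⟨y, hy⟩ : ∃ y, dotProduct (M.mulVec v) y ≠ 0 := by
      by_contra! hc
      exact hMv (dotProduct_eq_zero_iff.1 hc)
    let T : Matrix (Fin 5) (Fin 5) ℂ :=
      Matrix.vecMulVec x (M.mulVec y) - Matrix.vecMulVec y (M.mulVec x)
    have hT : T ∈ so5 M := by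
      rw [mem_so5_iff]
      have e : ∀ a b : Fin 5 → ℂ, (Matrix.vecMulVec a (M.mulVec b)).transpose * M
          = M * Matrix.vecMulVec b (M.mulVec a) := by
        intro a b
        rw [Matrix.transpose_vecMulVec, Matrix.vecMulVec_mul, Matrix.mul_vecMulVec]
        congr 1
        rw [← Matrix.mulVec_transpose, hs]
      simp only [T, Matrix.transpose_sub, Matrix.sub_mul, Matrix.mul_sub, e]
      abel
    have h1 : (⁅(⟨T, hT⟩ : so5 M), v⁆ : Fin 5 → ℂ) ∈ N := N.lie_mem hv
    have h2 : (⁅(⟨T, hT⟩ : so5 M), v⁆ : Fin 5 → ℂ) = dotProduct (M.mulVec v) y • x := by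
      change T.mulVec v = _
      have sw : ∀ a : Fin 5 → ℂ, dotProduct (M.mulVec a) v = dotProduct (M.mulVec v) a := by
        intro a
        rw [dotProduct_comm, Matrix.dotProduct_mulVec, ← Matrix.mulVec_transpose, hs]
      ext i
      simp [T, Matrix.sub_mulVec, Matrix.vecMulVec_mulVec, sw, hx, mul_comm]
    rw [h2] at h1
    have h3 := N.smul_mem (dotProduct (M.mulVec v) y)⁻¹ h1
    rwa [smul_smul, inv_mul_cancel₀ hy, one_smul] at h3
  obtain ⟨v, hv, hv0⟩ : ∃ v ∈ N, v ≠ 0 := by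
    by_contra! hc
    exact hN ((LieSubmodule.eq_bot_iff N).2 hc)
  have hdim : 4 ≤ Module.finrank ℂ (N : Submodule ℂ (Fin 5 → ℂ)) := by
    let φ : (Fin 5 → ℂ) →ₗ[ℂ] ℂ := dotProductBilin ℂ ℂ (M.mulVec v)
    have hk : LinearMap.ker φ ≤ (N : Submodule ℂ (Fin 5 → ℂ)) := fun x hx => key v hv hv0 x hx
    have h1 := Submodule.finrank_mono hk
    have h2 := φ.finrank_range_add_finrank_ker
    have h3 := Submodule.finrank_le (LinearMap.range φ)
    simp at h2 h3
    omega
  obtain ⟨w, hw, hwv⟩ : ∃ w ∈ N, w ∉ Submodule.span ℂ {v} := by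
    by_contra! hc
    have hle : (N : Submodule ℂ (Fin 5 → ℂ)) ≤ Submodule.span ℂ {v} := hc
    have h1 := Submodule.finrank_mono hle
    rw [finrank_span_singleton hv0] at h1
    omega
  have hw0 : w ≠ 0 := fun h => hwv (h ▸ Submodule.zero_mem _)
  obtain ⟨z, hz1, hz2⟩ : ∃ z, dotProduct (M.mulVec w) z = 0 ∧ dotProduct (M.mulVec v) z ≠ 0 := by
    by_contra! hc
    have hMw : M.mulVec w ≠ 0 := fun h => hw0 (Matrix.eq_zero_of_mulVec_eq_zero hdet h)
    obtain ⟨y, hy⟩ : ∃ y, dotProduct (M.mulVec w) y ≠ 0 := by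
      by_contra! h
      exact hMw (dotProduct_eq_zero_iff.1 h)
    set k := dotProduct (M.mulVec v) y / dotProduct (M.mulVec w) y with hk
    have hvk : M.mulVec (v - k • w) = 0 := by
      refine dotProduct_eq_zero_iff.1 fun x => ?_
      have h := hc (x - (dotProduct (M.mulVec w) x / dotProduct (M.mulVec w) y) • y) (by
        rw [dotProduct_sub, dotProduct_smul, smul_eq_mul, div_mul_cancel₀ _ hy, sub_self])
      rw [dotProduct_sub, dotProduct_smul, smul_eq_mul] at h
      rw [Matrix.mulVec_sub, Matrix.mulVec_smul, sub_dotProduct, smul_dotProduct, smul_eq_mul,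
        ← h, hk]
      ring
    have hvw : v = k • w := sub_eq_zero.1 (Matrix.eq_zero_of_mulVec_eq_zero hdet hvk)
    have hk0 : k ≠ 0 := fun h => hv0 (by rw [hvw, h, zero_smul])
    exact hwv (Submodule.mem_span_singleton.2 ⟨k⁻¹, by
      rw [hvw, smul_smul, inv_mul_cancel₀ hk0, one_smul]⟩)
  rw [eq_top_iff]
  intro x _
  have hzN := key w hw hw0 z hz1
  have h5 : x - (dotProduct (M.mulVec v) x / dotProduct (M.mulVec v) z) • z ∈ N := by
    apply key v hv hv0
    rw [dotProduct_sub, dotProduct_smul, smul_eq_mul, div_mul_cancel₀ _ hz2, sub_self]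
  have := N.add_mem h5 (N.smul_mem (dotProduct (M.mulVec v) x / dotProduct (M.mulVec v) z) hzN)
  simpa using this

instance so5_isKilling (M : Matrix (Fin 5) (Fin 5) ℂ) [IsNondegenerateSymmetric M] :
    LieAlgebra.IsKilling ℂ (so5 M) := by
  have := so5_isIrreducible M
  have : LieAlgebra.HasTrivialRadical ℂ (so5 M) :=
    LieAlgebra.hasTrivialRadical_of_isIrreducible_of_isFaithful ℂ (so5 M) (Fin 5 → ℂ) fun A => by
      have : LieModule.toEnd ℂ (so5 M) (Fin 5 → ℂ) A
          = Matrix.toLin' (A : Matrix (Fin 5) (Fin 5) ℂ) := rfl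
      rw [this, Matrix.trace_toLin'_eq, so5_trace_eq_zero]
  infer_instance

noncomputable section

open LieAlgebra.IsKilling

variable {M : Matrix (Fin 5) (Fin 5) ℂ} [IsNondegenerateSymmetric M]
  {H : LieSubalgebra ℂ (so5 M)} [H.IsCartanSubalgebra]

/-- The simple root with index `i`, as a linear form on the Cartan subalgebra. -/
def simpleRoot (b : (rootSystem H).Base) (i : b.support) : Module.Dual ℂ H :=
  (rootSystem H).root i

/-- The squared length of a root with respect to the canonical form on the root system, which is
invariant under the Weyl group and positive on roots. -/
def rootSqLength (α : H.root) : ℤ :=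
  ((rootSystem H).posRootForm ℤ).rootLength α

/-- The fundamental weights: the basis of the dual of the Cartan subalgebra that is dual to the
basis of simple coroots. -/
def fundamentalWeight (b : (rootSystem H).Base) (i : b.support) : Module.Dual ℂ H :=
  b.toCoweightBasis.coord i

/-- `V` is an irreducible module of highest weight `l`: it is irreducible and contains a nonzero
vector of weight `l` that is annihilated by the root spaces of all positive roots. -/
structure IsIrreducibleOfHighestWeight (b : (rootSystem H).Base) (V : Type*) [AddCommGroup V]
    [Module ℂ V] [LieRingModule (so5 M) V] [LieModule ℂ (so5 M) V]
    (l : Module.Dual ℂ H) : Prop where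
  irreducible : LieModule.IsIrreducible ℂ (so5 M) V
  exists_highestWeightVector : ∃ v : V, v ≠ 0 ∧ v ∈ LieModule.weightSpace V l ∧
    ∀ α : H.root, b.IsPos α → ∀ x ∈ LieAlgebra.rootSpace H α.1, ⁅x, v⁆ = 0

/-- The dimension of the space of vectors of weight `μ` in `V`. -/
def weightMultiplicity (V : Type*) [AddCommGroup V] [Module ℂ V] [LieRingModule (so5 M) V]
    [LieModule ℂ (so5 M) V] (μ : Module.Dual ℂ H) : ℕ :=
  Module.finrank ℂ (LieModule.weightSpace V μ)

end

/-! Let `v` be a highest weight vector, `eᵢ`, `fᵢ` simple raising and lowering elements. The Lie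
algebra is generated by its Cartan subalgebra and the simple root spaces of both signs, and the span
of the words `fᵢ₁ ⋯ fᵢₖ v` is stable under all of these. By irreducibility that span is all of `V`,
and `V_{λ-ν}` is spanned by the words whose letters add up to `ν` (`weightSpace_eq_span_word`).
Since the simple roots are independent, `ν = α₁`, `α₁ + α₂`, `2α₁ + α₂` leave only 1, 2, 3 words,
which bounds the dimensions from above.

For the lower bound, apply `e₁` and `e₂` to a linear relation among the words. The relation `[eᵢ,
fⱼ] = δᵢⱼ hᵢ` turns it into linear equations whose coefficients are polynomials in `λ₁`, `λ₂`, `p =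
-⟨α₂, α₁^∨⟩` and `q = -⟨α₁, α₂^∨⟩`, and a positive determinant forces the relation to be trivial.

Of the root system only `p ≥ 2` and `q ≥ 1` are needed (`exists_root_coroot_eq_neg`); these follow
from rank two and unequal root lengths. No finite-dimensionality of `V` is assumed. -/

namespace LieAlgebra.IsKilling

open LieModule Module

/-! ### Generation of a semisimple Lie algebra by simple root spaces -/

section Generation

variable {K L : Type*} [Field K] [CharZero K] [LieRing L] [LieAlgebra K L] [IsKilling K L]
  [FiniteDimensional K L] {H : LieSubalgebra K L} [H.IsCartanSubalgebra] [IsTriangularizable K H L]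

/-- If `α`, `β` and `α + β` are weights with `α ≠ 0`, then the root spaces of `α` and `β` do not
commute. -/
theorem exists_lie_ne_zero_of_rootSpace_add_ne_bot (α β : Weight K H L) (hα : α.IsNonZero)
    (h : rootSpace H (α + β : H → K) ≠ ⊥) :
    ∃ x ∈ rootSpace H α, ∃ y ∈ rootSpace H β, ⁅x, y⁆ ≠ 0 := by
  -- Take the string through `β` in direction `-α`, so that the lowering element of its `sl₂`-triple
  -- lies in the root space of `α`. From the top vector, `n` lowerings reach `β` and one more
  -- reaches `α + β`; it is nonzero because the string continues past `β`.
  obtain ⟨x, hx, hx0⟩ := (chainTop (-α : Weight K H L) β).exists_ne_zero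
  obtain ⟨h', e, f, isSl2, he, hf⟩ := exists_isSl2Triple_of_weight_isNonZero hα.neg
  obtain rfl := isSl2.h_eq_coroot hα.neg he hf
  have prim : isSl2.HasPrimitiveVectorWith x (chainLength (-α) β : K) :=
    have := lie_mem_genWeightSpace_of_mem_genWeightSpace he hx
    ⟨hx0, (chainLength_smul _ _ hx).symm, by rwa [genWeightSpace_add_chainTop _ _ hα.neg] at this⟩
  have hbot : 1 ≤ chainBotCoeff (-α : Weight K H L) β := by
    have := le_chainBotCoeff_of_rootSpace_ne_top (-α) β hα.neg 1 (by simpa using h)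
    exact_mod_cast this
  have hlen := chainBotCoeff_add_chainTopCoeff (-α) β
  set n := chainTopCoeff (-α : Weight K H L) β with hn
  refine ⟨f, by simpa using hf, ((toEnd K L L f) ^ n) x, ?_, ?_⟩
  · have := toEnd_pow_apply_mem hf hx n
    rw [coe_chainTop'] at this
    convert this using 2
    rw [← hn, smul_neg, neg_add_cancel_left]
  · have := prim.pow_toEnd_f_ne_zero_of_eq_nat rfl (i := n + 1) (by omega)
    rwa [← prim.lie_f_pow_toEnd_f] at this

theorem exists_smul_eq_of_mem_rootSpace {α : Weight K H L} (hα : α.IsNonZero) {x y : L}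
    (hx : x ∈ rootSpace H α) (hx0 : x ≠ 0) (hy : y ∈ rootSpace H α) : ∃ c : K, c • x = y := by
  obtain ⟨c, hc⟩ := (finrank_eq_one_iff_of_nonzero' (⟨x, hx⟩ : rootSpace H α)
    (by simpa [Subtype.ext_iff] using hx0)).1 (finrank_rootSpace_eq_one α hα) ⟨y, hy⟩
  exact ⟨c, congrArg Subtype.val hc⟩

/-- A nonzero bracket of the two root spaces fills the root space of the sum, which is
one-dimensional. -/
theorem rootSpace_add_le_of_le (S : LieSubalgebra K L) {α β γ : Weight K H L} (hα : α.IsNonZero)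
    (hγ : γ.IsNonZero) (h : (γ : H → K) = α + β)
    (hαS : ∀ x ∈ rootSpace H α, x ∈ S) (hβS : ∀ x ∈ rootSpace H β, x ∈ S) :
    ∀ x ∈ rootSpace H γ, x ∈ S := by
  intro z hz
  obtain ⟨x, hx, y, hy, hxy⟩ := exists_lie_ne_zero_of_rootSpace_add_ne_bot α β hα
    (h ▸ γ.genWeightSpace_ne_bot)
  have hmem : ⁅x, y⁆ ∈ rootSpace H γ := by
    rw [h]; exact lie_mem_genWeightSpace_of_mem_genWeightSpace hx hy
  obtain ⟨c, rfl⟩ := exists_smul_eq_of_mem_rootSpace hγ hmem hxy hz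
  exact S.smul_mem c (S.lie_mem (hαS x hx) (hβS y hy))

/-- A semisimple Lie algebra is generated by its Cartan subalgebra and the root spaces of the simple
roots and their negatives. -/
theorem mem_of_simple_rootSpace_le (b : (rootSystem H).Base) (S : LieSubalgebra K L)
    (hH : ∀ x ∈ H, x ∈ S)
    (hpos : ∀ i ∈ b.support, ∀ x ∈ rootSpace H i.1, x ∈ S)
    (hneg : ∀ i ∈ b.support, ∀ x ∈ rootSpace H (-i.1 : Weight K H L), x ∈ S) (x : L) : x ∈ S := by
  have key : ∀ i : H.root, b.IsPos i → (∀ x ∈ rootSpace H i.1, x ∈ S) ∧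
      (∀ x ∈ rootSpace H (-i.1 : Weight K H L), x ∈ S) := by
    intro i hi
    refine RootPairing.Base.IsPos.induction_on_add (b := b) (i := i) hi
      (p := fun i ↦ (∀ x ∈ rootSpace H i.1, x ∈ S) ∧
        (∀ x ∈ rootSpace H (-i.1 : Weight K H L), x ∈ S)) ?_ ?_
    · intro i hi
      exact ⟨hpos i hi, hneg i hi⟩
    · intro i j k hk hi hj
      have hk' : (k.1 : H → K) = i.1 + j.1 := congrArg (fun f : Dual K H ↦ (f : H → K)) hk
      have hi0 := H.isNonZero_coe_root i
      have hk0 := H.isNonZero_coe_root k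
      refine ⟨rootSpace_add_le_of_le S hi0 hk0 hk' hi.1 (hpos j hj),
        rootSpace_add_le_of_le S hi0.neg hk0.neg ?_ hi.2 (hneg j hj)⟩
      simp only [Weight.coe_neg, hk']
      abel
  have hall : ∀ α : Weight K H L, α.IsNonZero → ∀ x ∈ rootSpace H α, x ∈ S := by
    intro α hα
    let i : H.root := ⟨α, by simpa [LieSubalgebra.root] using hα⟩
    let := (rootSystem H).indexNeg
    rcases RootPairing.Base.IsPos.or_neg b i with hi | hi
    · exact (key i hi).1
    · have h := (key _ hi).2
      have e : -((-i : H.root).1) = α := by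
        ext y
        have h2 : (rootSystem H).root (-i) = -(rootSystem H).root i := by
          rw [RootPairing.indexNeg_neg, RootPairing.root_reflectionPerm,
            RootPairing.reflection_apply_self]
        have h3 : (-i : H.root).1 y = -α y := congrArg (fun f : Dual K H ↦ f y) h2
        rw [Weight.coe_neg, Pi.neg_apply, h3, neg_neg]
      rwa [e] at h
  have hx : x ∈ H.toLieSubmodule ⊔ ⨆ α : Weight K H L, ⨆ (_ : α.IsNonZero), rootSpace H α := by
    rw [cartan_sup_iSup_rootSpace_eq_top]; trivial
  rw [← LieSubmodule.mem_toSubmodule] at hx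
  have hle : (H.toLieSubmodule ⊔ ⨆ α : Weight K H L, ⨆ (_ : α.IsNonZero),
      rootSpace H α).toSubmodule ≤ S.toSubmodule := by
    simp only [LieSubmodule.sup_toSubmodule, LieSubmodule.iSup_toSubmodule, sup_le_iff,
      iSup_le_iff]
    exact ⟨fun y hy ↦ hH y hy, fun α hα y hy ↦ hall α hα y hy⟩
  exact hle hx

end Generation

end LieAlgebra.IsKilling

namespace LieAlgebra.IsKilling

open LieModule Module

/-! ### Spanning of irreducible highest weight modules by words -/

section HighestWeight

variable {K L : Type*} [Field K] [CharZero K] [LieRing L] [LieAlgebra K L] [IsKilling K L]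
  [FiniteDimensional K L] {H : LieSubalgebra K L} [H.IsCartanSubalgebra] [IsTriangularizable K H L]

/-- Raising and lowering elements for the simple roots of a base. -/
structure SimpleGenerators (b : (rootSystem H).Base) where
  /-- The raising elements. -/
  e : b.support → L
  /-- The lowering elements. -/
  f : b.support → L
  isSl2Triple (i : b.support) : IsSl2Triple (coroot i.1.1 : L) (e i) (f i)
  e_mem (i : b.support) : e i ∈ rootSpace H i.1.1
  f_mem (i : b.support) : f i ∈ rootSpace H (-i.1.1 : Weight K H L)

theorem nonempty_simpleGenerators (b : (rootSystem H).Base) : Nonempty (SimpleGenerators b) := by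
  have h (i : b.support) : ∃ e f : L, IsSl2Triple (coroot i.1.1 : L) e f ∧
      e ∈ rootSpace H i.1.1 ∧ f ∈ rootSpace H (-i.1.1 : Weight K H L) := by
    have hi := H.isNonZero_coe_root i.1
    obtain ⟨h', e, f, ht, he, hf⟩ := exists_isSl2Triple_of_weight_isNonZero hi
    obtain rfl := ht.h_eq_coroot hi he hf
    exact ⟨e, f, ht, he, hf⟩
  choose e f h₁ h₂ h₃ using h
  exact ⟨⟨e, f, h₁, h₂, h₃⟩⟩

namespace SimpleGenerators

variable {b : (rootSystem H).Base} (g : SimpleGenerators b)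

theorem lie_h_f (i : b.support) (h : H) :
    ⁅(h : L), g.f i⁆ = -((rootSystem H).root i h • g.f i) := by
  have := lie_eq_smul_of_mem_rootSpace (g.f_mem i) h
  simpa using this

/-- The bracket has weight `αᵢ - αⱼ`, which is nonzero and is not a root, because a root has simple
coordinates of a single sign. -/
theorem lie_e_f_of_ne {i j : b.support} (hij : i ≠ j) : ⁅g.e i, g.f j⁆ = 0 := by
  have hmem := lie_mem_genWeightSpace_of_mem_genWeightSpace (g.e_mem i) (g.f_mem j)
  by_contra h0
  let χ : Weight K H L := ⟨⇑i.1.1 + ⇑(-j.1.1 : Weight K H L), fun h ↦ h0 (by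
    rw [h] at hmem; exact (LieSubmodule.mem_bot _).1 hmem)⟩
  have hχ : (χ : H → K) = i.1.1 + (-j.1.1 : Weight K H L) := rfl
  have hχ' : Weight.toLinear K H L χ = (rootSystem H).root i - (rootSystem H).root j := by
    ext x
    simp [hχ, sub_eq_add_neg]
  have hχ0 : χ.IsNonZero := by
    intro h
    have h1 : (rootSystem H).root i - (rootSystem H).root j = 0 := by
      rw [← hχ', Weight.coe_toLinear_eq_zero_iff]; exact h
    exact hij (Subtype.ext ((rootSystem H).root.injective (sub_eq_zero.1 h1)))
  refine b.sub_notMem_range_root i.2 j.2 ⟨⟨χ, by simpa [LieSubalgebra.root] using hχ0⟩, ?_⟩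
  rw [← hχ']
  rfl

/-- The sum of the simple roots that are the letters of a word. -/
noncomputable def wordWeight (w : List b.support) : Dual K H :=
  (w.map fun i : b.support ↦ (rootSystem H).root i.1).sum

theorem wordWeight_cons (i : b.support) (w : List b.support) :
    wordWeight (i :: w) = (rootSystem H).root i + wordWeight w := by
  simp [wordWeight]

variable {V : Type*} [AddCommGroup V] [LieRingModule L V]

/-- The vector obtained by applying a word in the lowering elements to `v`. -/
def word (v : V) (w : List b.support) : V := w.foldr (fun i u ↦ ⁅g.f i, u⁆) v

@[simp] theorem word_nil (v : V) : g.word v [] = v := rfl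

@[simp] theorem word_cons (v : V) (i : b.support) (w : List b.support) :
    g.word v (i :: w) = ⁅g.f i, g.word v w⁆ := rfl

theorem lie_e_f_lie_of_ne {i j : b.support} (hij : i ≠ j) (u : V) :
    ⁅g.e i, ⁅g.f j, u⁆⁆ = ⁅g.f j, ⁅g.e i, u⁆⁆ := by
  rw [leibniz_lie, g.lie_e_f_of_ne hij, zero_lie, zero_add]

variable [Module K V]

theorem lie_e_f_lie {i : b.support} {u : V} {c : K} (h : ⁅(coroot i.1.1 : L), u⁆ = c • u) :
    ⁅g.e i, ⁅g.f i, u⁆⁆ = c • u + ⁅g.f i, ⁅g.e i, u⁆⁆ := by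
  rw [leibniz_lie, (g.isSl2Triple i).lie_e_f, h]

variable [LieModule K L V]

theorem lie_word {v : V} {l : Dual K H} (hv : ∀ h : H, ⁅(h : L), v⁆ = l h • v)
    (w : List b.support) (h : H) : ⁅(h : L), g.word v w⁆ =
      (l - wordWeight w) h • g.word v w := by
  induction w with
  | nil => simp [hv, wordWeight]
  | cons i w ih =>
    rw [word_cons, leibniz_lie, g.lie_h_f, ih, neg_lie, smul_lie, lie_smul, ← neg_smul, ← add_smul]
    congr 1
    simp only [wordWeight_cons, LinearMap.sub_apply, LinearMap.add_apply]
    ring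

theorem lie_f_mem_span_word {v : V} (i : b.support) {u : V}
    (hu : u ∈ Submodule.span K (Set.range (g.word v))) :
    ⁅g.f i, u⁆ ∈ Submodule.span K (Set.range (g.word v)) := by
  induction hu using Submodule.span_induction with
  | mem x hx =>
    obtain ⟨w, rfl⟩ := hx
    exact Submodule.subset_span ⟨i :: w, rfl⟩
  | zero => simp
  | add x y _ _ hx hy => rw [lie_add]; exact add_mem hx hy
  | smul c x _ hx => rw [lie_smul]; exact Submodule.smul_mem _ c hx

theorem lie_h_mem_span_word {v : V} {l : Dual K H} (hv : ∀ h : H, ⁅(h : L), v⁆ = l h • v)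
    (h : H) {u : V} (hu : u ∈ Submodule.span K (Set.range (g.word v))) :
    ⁅(h : L), u⁆ ∈ Submodule.span K (Set.range (g.word v)) := by
  induction hu using Submodule.span_induction with
  | mem x hx =>
    obtain ⟨w, rfl⟩ := hx
    rw [g.lie_word hv]
    exact Submodule.smul_mem _ _ (Submodule.subset_span ⟨w, rfl⟩)
  | zero => simp
  | add x y _ _ hx hy => rw [lie_add]; exact add_mem hx hy
  | smul c x _ hx => rw [lie_smul]; exact Submodule.smul_mem _ c hx

/-- Commuting `eᵢ` to the right past each letter leaves only scalar multiples of shorter words,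
since every word is a weight vector, until `eᵢ` reaches `v` and kills it. -/
theorem lie_e_word_mem_span_word {v : V} {l : Dual K H} (hv : ∀ h : H, ⁅(h : L), v⁆ = l h • v)
    (he : ∀ i, ⁅g.e i, v⁆ = 0) (i : b.support) (w : List b.support) :
    ⁅g.e i, g.word v w⁆ ∈ Submodule.span K (Set.range (g.word v)) := by
  induction w with
  | nil => simp [he]
  | cons j w ih =>
    rw [word_cons]
    rcases eq_or_ne i j with rfl | hij
    · rw [g.lie_e_f_lie (g.lie_word hv w _)]
      exact add_mem (Submodule.smul_mem _ _ (Submodule.subset_span ⟨w, rfl⟩))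
        (g.lie_f_mem_span_word i ih)
    · rw [g.lie_e_f_lie_of_ne hij]
      exact g.lie_f_mem_span_word j ih

theorem lie_e_mem_span_word {v : V} {l : Dual K H} (hv : ∀ h : H, ⁅(h : L), v⁆ = l h • v)
    (he : ∀ i, ⁅g.e i, v⁆ = 0) (i : b.support) {u : V}
    (hu : u ∈ Submodule.span K (Set.range (g.word v))) :
    ⁅g.e i, u⁆ ∈ Submodule.span K (Set.range (g.word v)) := by
  induction hu using Submodule.span_induction with
  | mem x hx =>
    obtain ⟨w, rfl⟩ := hx
    exact g.lie_e_word_mem_span_word hv he i w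
  | zero => simp
  | add x y _ _ hx hy => rw [lie_add]; exact add_mem hx hy
  | smul c x _ hx => rw [lie_smul]; exact Submodule.smul_mem _ c hx

/-- An irreducible highest weight module is spanned by the words in the lowering elements applied
to a highest weight vector. -/
theorem span_word_eq_top [LieModule.IsIrreducible K L V] {v : V} (hv0 : v ≠ 0) {l : Dual K H}
    (hv : ∀ h : H, ⁅(h : L), v⁆ = l h • v) (he : ∀ i, ⁅g.e i, v⁆ = 0) :
    Submodule.span K (Set.range (g.word v)) = ⊤ := by
  -- The stabilizer of the span of words is a Lie subalgebra, so it suffices to test generators.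
  let S : LieSubalgebra K L :=
    { carrier := {x | ∀ u ∈ Submodule.span K (Set.range (g.word v)),
        ⁅x, u⁆ ∈ Submodule.span K (Set.range (g.word v))}
      add_mem' := fun ha hb u hu ↦ by rw [add_lie]; exact add_mem (ha u hu) (hb u hu)
      zero_mem' := fun u _ ↦ by simp
      smul_mem' := fun c x hx u hu ↦ by rw [smul_lie]; exact Submodule.smul_mem _ c (hx u hu)
      lie_mem' := fun {x y} hx hy u hu ↦ by
        rw [lie_lie]; exact sub_mem (hx _ (hy u hu)) (hy _ (hx u hu)) }
  have hS (x : L) : x ∈ S := by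
    refine mem_of_simple_rootSpace_le b S (fun x hx u hu ↦ g.lie_h_mem_span_word hv ⟨x, hx⟩ hu)
      (fun i hi x hx ↦ ?_) (fun i hi x hx ↦ ?_) x
    · obtain ⟨c, rfl⟩ := exists_smul_eq_of_mem_rootSpace (H.isNonZero_coe_root i)
        (g.e_mem ⟨i, hi⟩) (g.isSl2Triple ⟨i, hi⟩).e_ne_zero hx
      exact S.smul_mem c fun u hu ↦ g.lie_e_mem_span_word hv he ⟨i, hi⟩ hu
    · obtain ⟨c, rfl⟩ := exists_smul_eq_of_mem_rootSpace (H.isNonZero_coe_root i).neg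
        (g.f_mem ⟨i, hi⟩) (g.isSl2Triple ⟨i, hi⟩).f_ne_zero hx
      exact S.smul_mem c fun u hu ↦ g.lie_f_mem_span_word ⟨i, hi⟩ hu
  let N : LieSubmodule K L V :=
    { Submodule.span K (Set.range (g.word v)) with lie_mem := fun {x u} hu ↦ hS x u hu }
  have hvN : v ∈ N := Submodule.subset_span (s := Set.range (g.word v)) ⟨[], rfl⟩
  rcases eq_bot_or_eq_top N with h | h
  · exact absurd (by simpa [h] using hvN) hv0
  · exact congrArg LieSubmodule.toSubmodule h

/-- A weight space of an irreducible highest weight module is spanned by the words of that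
weight. -/
theorem weightSpace_eq_span_word [LieModule.IsIrreducible K L V] {v : V} (hv0 : v ≠ 0)
    {l : Dual K H} (hv : ∀ h : H, ⁅(h : L), v⁆ = l h • v) (he : ∀ i, ⁅g.e i, v⁆ = 0)
    (n : Dual K H) :
    (weightSpace V (l - n : Dual K H)).toSubmodule =
      Submodule.span K (g.word v '' {w | wordWeight w = n}) := by
  have hword (w : List b.support) : g.word v w ∈
      weightSpace V (l - wordWeight w : Dual K H) :=
    (mem_weightSpace _ _).2 fun h ↦ g.lie_word hv w h
  have hle : Submodule.span K (g.word v '' {w | wordWeight w = n}) ≤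
      (weightSpace V (l - n : Dual K H)).toSubmodule := by
    rw [Submodule.span_le]
    rintro _ ⟨w, rfl, rfl⟩
    exact hword w
  refine le_antisymm (fun u hu ↦ ?_) hle
  set A := {w : List b.support | wordWeight w = n} with hA
  have huT : u ∈ Submodule.span K (g.word v '' A) ⊔ Submodule.span K (g.word v '' Aᶜ) := by
    rw [← Submodule.span_union, ← Set.image_union, Set.union_compl_self, Set.image_univ,
      g.span_word_eq_top hv0 hv he]
    trivial
  obtain ⟨x, hx, y, hy, rfl⟩ := Submodule.mem_sup.1 huT
  -- The component `y` along words of other weights equals `u - x`, so it also has weight `l - n`;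
  -- independence of generalized weight spaces kills it.
  suffices y = 0 by simpa [this] using hx
  have hy1 : y ∈ genWeightSpace V (l - n : Dual K H) := by
    refine weightSpace_le_genWeightSpace V _ ?_
    have := sub_mem hu (hle hx)
    simpa using this
  have hy2 : y ∈ (⨆ (χ : H → K) (_ : χ ≠ (l - n : Dual K H)), genWeightSpace V χ) := by
    rw [← LieSubmodule.mem_toSubmodule]
    refine (Submodule.span_le.2 ?_ : Submodule.span K (g.word v '' Aᶜ) ≤ _) hy
    rintro _ ⟨w, hw, rfl⟩
    refine (le_iSup₂_of_le (f := fun (χ : H → K) (_ : χ ≠ (l - n : Dual K H)) ↦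
      genWeightSpace V χ) _ ?_ le_rfl) (weightSpace_le_genWeightSpace V _ (hword w))
    intro h
    exact hw (sub_right_injective (DFunLike.coe_injective h))
  have := (iSupIndep_genWeightSpace K H V (l - n : Dual K H)).le_bot ⟨hy1, hy2⟩
  simpa using this

end SimpleGenerators

end HighestWeight

end LieAlgebra.IsKilling

/-! ### Linear algebra of the raising equations -/

section LinearIndependence

variable {K V : Type*} [Field K] [CharZero K] [AddCommGroup V] [Module K V]

/-- Linear independence of the words `f₁f₂v` and `f₂f₁v`. -/
theorem linearIndependent_words_of_raising {a c p q : ℕ} (ha : 1 ≤ a) (hq : 1 ≤ q)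
    (E₁ E₂ : V →ₗ[K] V) {x₁ x₂ x₁₂ x₂₁ : V} (h₁ : x₁ ≠ 0) (h₂ : x₂ ≠ 0)
    (h₁₁₂ : E₁ x₁₂ = (a + p : K) • x₂) (h₁₂₁ : E₁ x₂₁ = (a : K) • x₂)
    (h₂₁₂ : E₂ x₁₂ = (c : K) • x₁) (h₂₂₁ : E₂ x₂₁ = (c + q : K) • x₁) :
    LinearIndependent K ![x₁₂, x₂₁] := by
  rw [LinearIndependent.pair_iff]
  intro s t hst
  have e₁ : (s * (a + p) + t * a) • x₂ = 0 := by
    have := congrArg E₁ hst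
    simpa [h₁₁₂, h₁₂₁, smul_smul, ← add_smul] using this
  have e₂ : (s * c + t * (c + q)) • x₁ = 0 := by
    have := congrArg E₂ hst
    simpa [h₂₁₂, h₂₂₁, smul_smul, ← add_smul] using this
  replace e₁ := (smul_eq_zero.1 e₁).resolve_right h₂
  replace e₂ := (smul_eq_zero.1 e₂).resolve_right h₁
  -- The determinant `(a + p)(c + q) - ac`.
  have hdet : ((a * q + p * c + p * q : ℕ) : K) ≠ 0 := by
    have : 0 < a * q := Nat.mul_pos ha hq
    exact Nat.cast_ne_zero.2 (by omega)
  push_cast at hdet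
  constructor
  · refine (mul_eq_zero.1 ?_).resolve_right hdet
    linear_combination (c + q : K) * e₁ - (a : K) * e₂
  · refine (mul_eq_zero.1 ?_).resolve_right hdet
    linear_combination (a + p : K) * e₂ - (c : K) * e₁

/-- Linear independence of the words `f₁f₁f₂v`, `f₁f₂f₁v` and `f₂f₁f₁v`. -/
theorem linearIndependent_words_of_raising' {a c p q : ℕ} (ha : 2 ≤ a) (hp : 2 ≤ p) (hq : 1 ≤ q)
    (E₁ E₂ : V →ₗ[K] V) {x₁₁ x₁₂ x₂₁ x₁₁₂ x₁₂₁ x₂₁₁ : V} (h₁₁ : x₁₁ ≠ 0)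
    (hind : LinearIndependent K ![x₁₂, x₂₁])
    (h₁ : E₁ x₁₁₂ = (2 * a + 2 * p - 2 : K) • x₁₂)
    (h₂ : E₁ x₁₂₁ = (a + p - 2 : K) • x₂₁ + (a : K) • x₁₂)
    (h₃ : E₁ x₂₁₁ = (2 * a - 2 : K) • x₂₁)
    (h₄ : E₂ x₁₁₂ = (c : K) • x₁₁) (h₅ : E₂ x₁₂₁ = (c + q : K) • x₁₁)
    (h₆ : E₂ x₂₁₁ = (c + 2 * q : K) • x₁₁) :
    LinearIndependent K ![x₁₁₂, x₁₂₁, x₂₁₁] := by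
  rw [Fintype.linearIndependent_iff]
  intro s hs
  simp only [Fin.sum_univ_three, Matrix.cons_val_zero, Matrix.cons_val_one, Matrix.cons_val] at hs
  have e₁₂ : (s 0 * (2 * a + 2 * p - 2) + s 1 * a) • x₁₂
      + (s 1 * (a + p - 2) + s 2 * (2 * a - 2)) • x₂₁ = 0 := by
    have := congrArg E₁ hs
    simp only [map_add, map_smul, h₁, h₂, h₃, map_zero] at this
    rw [← this]
    module
  have e₃ : (s 0 * c + s 1 * (c + q) + s 2 * (c + 2 * q)) • x₁₁ = 0 := by
    have := congrArg E₂ hs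
    simpa [h₄, h₅, h₆, smul_smul, ← add_smul] using this
  obtain ⟨e₁, e₂⟩ := LinearIndependent.pair_iff.1 hind _ _ e₁₂
  replace e₃ := (smul_eq_zero.1 e₃).resolve_right h₁₁
  obtain ⟨m, rfl⟩ := Nat.exists_eq_add_of_le ha
  obtain ⟨n, rfl⟩ := Nat.exists_eq_add_of_le hp
  push_cast at e₁ e₂ e₃
  -- With `m = a - 2` and `n = p - 2` this is `(p - 1)(cp + 2q(a + p - 1))`. It vanishes at `p = 1`,
  -- where the Serre relation `f₁²f₂ - 2f₁f₂f₁ + f₂f₁² = 0` makes the words dependent.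
  have hdet : ((c * (n + 2) * (n + 1) + 2 * q * (m + n + 3) * (n + 1) : ℕ) : K) ≠ 0 := by
    have : 0 < 2 * q * (m + n + 3) * (n + 1) := by positivity
    exact Nat.cast_ne_zero.2 (by omega)
  have hm₁ : (m + 1 : K) ≠ 0 := by exact_mod_cast Nat.succ_ne_zero m
  have hm₂ : (2 + m : K) ≠ 0 := by exact_mod_cast (by omega : 2 + m ≠ 0)
  push_cast at hdet
  -- The two `E₁` equations determine `s 1` and `s 2` from `s 0`; the divisors `2 + m` and `m + 1`
  -- are `a` and `a - 1`. The `E₂` equation then becomes the determinant times `s 0`.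
  have s₁ : s 1 = -(2 * (m + n + 3) / (2 + m)) * s 0 := by
    field_simp
    linear_combination e₁
  have s₂ : s 2 = (m + n + 3) * (m + n + 2) / ((2 + m) * (m + 1)) * s 0 := by
    rw [s₁] at e₂
    field_simp at e₂ ⊢
    linear_combination e₂ / 2
  have s₀ : s 0 = 0 := by
    refine (mul_eq_zero.1 ?_).resolve_left hdet
    rw [s₁, s₂] at e₃
    field_simp at e₃
    linear_combination e₃
  intro i
  fin_cases i <;> simp [s₀, s₁, s₂]

end LinearIndependence

namespace LieAlgebra.IsKilling

open LieModule Module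

/-! ### Cartan integers and word weights in rank two -/

section RankTwo

variable {K L : Type*} [Field K] [CharZero K] [LieRing L] [LieAlgebra K L] [IsKilling K L]
  [FiniteDimensional K L] {H : LieSubalgebra K L} [H.IsCartanSubalgebra] [IsTriangularizable K H L]
  {b : (rootSystem H).Base} {i₁ i₂ : b.support}

/-- If the two simple roots of a root system of rank two are orthogonal, every positive root is
simple. -/
theorem eq_or_eq_of_isPos_of_pairingIn_eq_zero (hall : ∀ i : b.support, i = i₁ ∨ i = i₂)
    (hne : i₁ ≠ i₂) (h0 : (rootSystem H).pairingIn ℤ i₁ i₂ = 0) {k : H.root} (hk : b.IsPos k) :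
    k = i₁ ∨ k = i₂ := by
  have hsum (i j : b.support) (hij : i ≠ j) (h : (rootSystem H).pairingIn ℤ i j = 0) :
      (rootSystem H).root i + (rootSystem H).root j ∉ Set.range (rootSystem H).root := by
    -- The string of one simple root through another extends upwards by minus their Cartan integer,
    -- here zero.
    have h1 := b.chainTopCoeff_eq_of_ne hij.symm
    rw [h, neg_zero, Nat.cast_eq_zero, RootPairing.chainTopCoeff_eq_zero_iff] at h1
    exact h1.resolve_left (not_not.2 (b.linearIndependent_pair_of_ne hij.symm))
  refine RootPairing.Base.IsPos.induction_on_add (b := b) (i := k) hk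
    (p := fun k ↦ k = i₁ ∨ k = i₂) (fun i hi ↦ ?_) (fun i j k hk hi hj ↦ ?_)
  · exact (hall ⟨i, hi⟩).imp (congrArg Subtype.val) (congrArg Subtype.val)
  · exfalso
    obtain ⟨i, rfl⟩ : ∃ i' : b.support, (i' : H.root) = i := by
      rcases hi with rfl | rfl
      exacts [⟨i₁, rfl⟩, ⟨i₂, rfl⟩]
    lift j to b.support using hj
    rcases eq_or_ne i j with rfl | hij
    · have : IsAddTorsionFree (Dual K H) := .of_isTorsionFree K _
      exact (rootSystem H).nsmul_notMem_range_root (n := 2) (i := i.1) ⟨k, by rw [hk, two_nsmul]⟩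
    · refine hsum i j hij ?_ ⟨k, hk⟩
      rcases hall i with rfl | rfl <;> rcases hall j with rfl | rfl
      · exact absurd rfl hij
      · exact h0
      · exact (rootSystem H).pairingIn_eq_zero_iff.1 h0
      · exact absurd rfl hij

/-- The canonical form gives `Σ_β ⟨α₁, β^∨⟩²` over all roots `β`. In type `A₁ × A₁` only `β = ±α₁`
contribute, each giving `4`. By symmetry `α₂` has the same length, so a strict length inequality
excludes orthogonal simple roots. -/
theorem rootLength_eq_eight (hall : ∀ i : b.support, i = i₁ ∨ i = i₂)
    (hne : i₁ ≠ i₂) (h0 : (rootSystem H).pairingIn ℤ i₁ i₂ = 0) :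
    ((rootSystem H).posRootForm ℤ).rootLength i₁ = 8 := by
  classical
  let := (rootSystem H).indexNeg
  have hp0 : (rootSystem H).pairing i₁ i₂ = 0 := by
    rw [← (rootSystem H).algebraMap_pairingIn ℤ, h0, map_zero]
  have hneg (j k : H.root) : (rootSystem H).pairing j (-k) = -(rootSystem H).pairing j k := by
    rw [RootPairing.indexNeg_neg, RootPairing.pairing_reflectionPerm_self_right]
  have hne' : (i₁ : H.root) ≠ -i₁ := by
    intro h
    have h1 := hneg i₁ i₁
    rw [← h, RootPairing.pairing_same] at h1
    norm_num at h1
  have hsum : (rootSystem H).RootForm ((rootSystem H).root i₁) ((rootSystem H).root i₁) = 8 := by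
    rw [RootPairing.rootForm_apply_apply]
    simp only [RootPairing.root_coroot'_eq_pairing]
    rw [← Finset.sum_subset (Finset.subset_univ {(i₁ : H.root), -(i₁ : H.root)})]
    · rw [Finset.sum_pair hne', hneg, RootPairing.pairing_same]
      norm_num
    · intro k _ hk
      simp only [Finset.mem_insert, Finset.mem_singleton, not_or] at hk
      rcases RootPairing.Base.IsPos.or_neg b k with hpos | hpos
      · rcases eq_or_eq_of_isPos_of_pairingIn_eq_zero hall hne h0 hpos with h | h
        · exact absurd h hk.1
        · rw [h, hp0, mul_zero]
      · rcases eq_or_eq_of_isPos_of_pairingIn_eq_zero hall hne h0 hpos with h | h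
        · exact absurd (by rw [← h, neg_neg]) hk.2
        · have : k = -i₂ := by rw [← h, neg_neg]
          rw [this, hneg, hp0, neg_zero, mul_zero]
  have h1 := ((rootSystem H).posRootForm ℤ).algebraMap_rootLength i₁
  have h2 : ((rootSystem H).posRootForm ℤ).form = (rootSystem H).RootForm := rfl
  rw [h2, hsum, eq_intCast] at h1
  exact_mod_cast h1

/-- The Cartan integers of two simple roots of different lengths. -/
theorem exists_root_coroot_eq_neg (hall : ∀ i : b.support, i = i₁ ∨ i = i₂)
    (hlong : ((rootSystem H).posRootForm ℤ).rootLength i₁ <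
      ((rootSystem H).posRootForm ℤ).rootLength i₂) :
    ∃ p q : ℕ, 2 ≤ p ∧ 1 ≤ q ∧ (rootSystem H).root i₂ (coroot i₁.1.1) = -(p : K) ∧
      (rootSystem H).root i₁ (coroot i₂.1.1) = -(q : K) := by
  have hne : i₁ ≠ i₂ := by
    rintro rfl
    exact lt_irrefl _ hlong
  have hne' : (i₁ : H.root) ≠ i₂ := fun h ↦ hne (Subtype.ext h)
  have hp := b.pairingIn_le_zero_of_ne hne'.symm i₂.2 i₁.2
  have hq := b.pairingIn_le_zero_of_ne hne' i₁.2 i₂.2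
  have hq0 : (rootSystem H).pairingIn ℤ i₁ i₂ ≠ 0 := by
    intro h0
    have h1 := rootLength_eq_eight hall hne h0
    have h2 := rootLength_eq_eight (fun i ↦ (hall i).symm) hne.symm
      ((rootSystem H).pairingIn_eq_zero_iff.1 h0)
    rw [h1, h2] at hlong
    exact lt_irrefl _ hlong
  have hswap :=
    ((rootSystem H).posRootForm ℤ).pairingIn_mul_eq_pairingIn_mul_swap i₁.1 i₂.1
  have hpos := ((rootSystem H).posRootForm ℤ).rootLength_pos i₁.1
  have ep : (((rootSystem H).pairingIn ℤ i₂ i₁ : ℤ) : K) =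
      (rootSystem H).root i₂ (coroot i₁.1.1) := (rootSystem H).algebraMap_pairingIn ℤ i₂.1 i₁.1
  have eq : (((rootSystem H).pairingIn ℤ i₁ i₂ : ℤ) : K) =
      (rootSystem H).root i₁ (coroot i₂.1.1) := (rootSystem H).algebraMap_pairingIn ℤ i₁.1 i₂.1
  rw [← ep, ← eq]
  generalize (rootSystem H).pairingIn ℤ i₂ i₁ = x at *
  generalize (rootSystem H).pairingIn ℤ i₁ i₂ = y at *
  obtain ⟨p, rfl⟩ := Int.exists_eq_neg_ofNat hp
  obtain ⟨q, rfl⟩ := Int.exists_eq_neg_ofNat hq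
  refine ⟨p, q, ?_, by omega, by simp, by simp⟩
  have hq1 : (1 : ℤ) ≤ q := by omega
  -- Invariance of the form gives `q|α₂|² = p|α₁|²`; with `|α₁|² < |α₂|²` and `q ≥ 1`, the value `p
  -- ≤ 1` is impossible.
  have : (1 : ℤ) < p := by
    by_contra! hcon
    nlinarith
  omega

namespace SimpleGenerators

theorem wordWeight_eq_count (hall : ∀ i : b.support, i = i₁ ∨ i = i₂) (hne : i₁ ≠ i₂)
    [DecidableEq b.support] (w : List b.support) : wordWeight w =
      (w.count i₁ : K) • (rootSystem H).root i₁ + (w.count i₂ : K) • (rootSystem H).root i₂ := by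
  induction w with
  | nil => simp [wordWeight]
  | cons i w ih =>
    rw [wordWeight_cons, ih]
    rcases hall i with rfl | rfl
    · simp only [List.count_cons_self, List.count_cons_of_ne hne]
      push_cast
      module
    · simp only [List.count_cons_self, List.count_cons_of_ne hne.symm]
      push_cast
      module

/-- Linear independence of the simple roots lets the weight recover the letter counts. -/
theorem wordWeight_eq_iff (hall : ∀ i : b.support, i = i₁ ∨ i = i₂) (hne : i₁ ≠ i₂)
    [DecidableEq b.support] (w : List b.support) (m n : ℕ) :
    wordWeight w = m • (rootSystem H).root i₁ + n • (rootSystem H).root i₂ ↔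
      w.count i₁ = m ∧ w.count i₂ = n := by
  rw [wordWeight_eq_count hall hne, ← Nat.cast_smul_eq_nsmul K m, ← Nat.cast_smul_eq_nsmul K n]
  constructor
  · intro h
    obtain ⟨h₁, h₂⟩ := (b.linearIndependent_pair_of_ne hne).eq_of_pair h
    exact ⟨by exact_mod_cast h₁, by exact_mod_cast h₂⟩
  · rintro ⟨rfl, rfl⟩
    rfl

end SimpleGenerators

end RankTwo

end LieAlgebra.IsKilling

/-! ### Words on two letters with prescribed letter counts -/

namespace List

variable {ι : Type*} [DecidableEq ι] {a b : ι}

theorem length_eq_count_add_count (hall : ∀ i : ι, i = a ∨ i = b) (hne : a ≠ b) (w : List ι) :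
    w.length = w.count a + w.count b := by
  induction w with
  | nil => simp
  | cons i w ih =>
    rcases hall i with rfl | rfl
    · simp only [length_cons, ih, count_cons_self, count_cons_of_ne hne]
      omega
    · simp only [length_cons, ih, count_cons_self, count_cons_of_ne hne.symm]
      omega

theorem setOf_count_eq_one_zero (hall : ∀ i : ι, i = a ∨ i = b) (hne : a ≠ b) :
    {w : List ι | w.count a = 1 ∧ w.count b = 0} = {[a]} := by
  ext w
  simp only [Set.mem_ofPred_eq, Set.mem_singleton_iff]
  refine ⟨fun h ↦ ?_, by rintro rfl; simp [hne]⟩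
  have hl := w.length_eq_count_add_count hall hne
  rw [h.1, h.2] at hl
  obtain ⟨x, rfl⟩ := length_eq_one_iff.1 hl
  rcases hall x with rfl | rfl
  · rfl
  · simp at h

theorem setOf_count_eq_one_one (hall : ∀ i : ι, i = a ∨ i = b) (hne : a ≠ b) :
    {w : List ι | w.count a = 1 ∧ w.count b = 1} = {[a, b], [b, a]} := by
  ext w
  simp only [Set.mem_ofPred_eq, Set.mem_insert_iff, Set.mem_singleton_iff]
  refine ⟨fun h ↦ ?_, by rintro (rfl | rfl) <;> simp [hne, hne.symm]⟩
  have hl := w.length_eq_count_add_count hall hne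
  rw [h.1, h.2] at hl
  obtain ⟨x, y, rfl⟩ := length_eq_two.1 hl
  rcases hall x with rfl | rfl <;> rcases hall y with rfl | rfl <;>
    simp_all [hne.symm]

theorem setOf_count_eq_two_one (hall : ∀ i : ι, i = a ∨ i = b) (hne : a ≠ b) :
    {w : List ι | w.count a = 2 ∧ w.count b = 1} = {[a, a, b], [a, b, a], [b, a, a]} := by
  ext w
  simp only [Set.mem_ofPred_eq, Set.mem_insert_iff, Set.mem_singleton_iff]
  refine ⟨fun h ↦ ?_, by rintro (rfl | rfl | rfl) <;> simp [hne, hne.symm]⟩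
  have hl := w.length_eq_count_add_count hall hne
  rw [h.1, h.2] at hl
  obtain ⟨x, y, z, rfl⟩ := length_eq_three.1 hl
  rcases hall x with rfl | rfl <;> rcases hall y with rfl | rfl <;>
    rcases hall z with rfl | rfl <;> simp_all [hne.symm]

end List

namespace LieAlgebra.IsKilling.SimpleGenerators

open LieModule Module

/-! ### Weight multiplicities near the highest weight -/

section RankTwoMultiplicities

variable {K L : Type*} [Field K] [CharZero K] [LieRing L] [LieAlgebra K L] [IsKilling K L]
  [FiniteDimensional K L] {H : LieSubalgebra K L} [H.IsCartanSubalgebra] [IsTriangularizable K H L]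
  {b : (rootSystem H).Base} (g : SimpleGenerators b)
  {V : Type*} [AddCommGroup V] [LieRingModule L V]

theorem lie_e_word_cons_of_ne {i j : b.support} (hij : i ≠ j) (v : V) (w : List b.support) :
    ⁅g.e i, g.word v (j :: w)⁆ = ⁅g.f j, ⁅g.e i, g.word v w⁆⁆ :=
  g.lie_e_f_lie_of_ne hij _

variable [Module K V] [LieModule K L V]

theorem lie_e_word_cons_self {v : V} {l : Dual K H} (hv : ∀ h : H, ⁅(h : L), v⁆ = l h • v)
    (i : b.support) (w : List b.support) : ⁅g.e i, g.word v (i :: w)⁆ =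
      (l - wordWeight w) (coroot i.1.1) • g.word v w + ⁅g.f i, ⁅g.e i, g.word v w⁆⁆ :=
  g.lie_e_f_lie (g.lie_word hv w _)

/-- Raising gives `eᵢfᵢv = ⟨l, αᵢ^∨⟩v ≠ 0`. -/
theorem word_singleton_ne_zero {v : V} (hv0 : v ≠ 0) {l : Dual K H}
    (hv : ∀ h : H, ⁅(h : L), v⁆ = l h • v) (he : ∀ i, ⁅g.e i, v⁆ = 0) (i : b.support)
    (hi : l (coroot i.1.1) ≠ 0) : g.word v [i] ≠ 0 := by
  intro h
  have h1 := g.lie_e_word_cons_self hv i []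
  rw [h, lie_zero, word_nil, he, lie_zero, add_zero] at h1
  exact smul_ne_zero hi hv0 (by simpa [wordWeight] using h1.symm)

variable {i₁ i₂ : b.support}

/-- The action of the raising elements on short words in the lowering elements. -/
theorem lie_e_word_table (hne : i₁ ≠ i₂) {v : V} {l : Dual K H}
    (hv : ∀ h : H, ⁅(h : L), v⁆ = l h • v) (he : ∀ i, ⁅g.e i, v⁆ = 0) {a c p q : K}
    (ha : l (coroot i₁.1.1) = a) (hc : l (coroot i₂.1.1) = c)
    (hp : (rootSystem H).root i₂ (coroot i₁.1.1) = -p)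
    (hq : (rootSystem H).root i₁ (coroot i₂.1.1) = -q) :
    (⁅g.e i₁, g.word v [i₁, i₂]⁆ = (a + p) • g.word v [i₂] ∧
      ⁅g.e i₁, g.word v [i₂, i₁]⁆ = a • g.word v [i₂] ∧
      ⁅g.e i₂, g.word v [i₁, i₂]⁆ = c • g.word v [i₁] ∧
      ⁅g.e i₂, g.word v [i₂, i₁]⁆ = (c + q) • g.word v [i₁] ∧
      ⁅g.e i₁, g.word v [i₁, i₁]⁆ = (2 * a - 2) • g.word v [i₁]) ∧
    ⁅g.e i₁, g.word v [i₁, i₁, i₂]⁆ = (2 * a + 2 * p - 2) • g.word v [i₁, i₂] ∧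
      ⁅g.e i₁, g.word v [i₁, i₂, i₁]⁆ =
        (a + p - 2) • g.word v [i₂, i₁] + a • g.word v [i₁, i₂] ∧
      ⁅g.e i₁, g.word v [i₂, i₁, i₁]⁆ = (2 * a - 2) • g.word v [i₂, i₁] ∧
      ⁅g.e i₂, g.word v [i₁, i₁, i₂]⁆ = c • g.word v [i₁, i₁] ∧
      ⁅g.e i₂, g.word v [i₁, i₂, i₁]⁆ = (c + q) • g.word v [i₁, i₁] ∧
      ⁅g.e i₂, g.word v [i₂, i₁, i₁]⁆ = (c + 2 * q) • g.word v [i₁, i₁] := by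
  have h11 : (rootSystem H).root i₁ (coroot i₁.1.1) = 2 :=
    root_apply_coroot (H.isNonZero_coe_root i₁.1)
  have hself₁ (w : List b.support) : ⁅g.e i₁, g.word v (i₁ :: w)⁆ =
      (a - wordWeight w (coroot i₁.1.1)) • g.word v w + ⁅g.f i₁, ⁅g.e i₁, g.word v w⁆⁆ := by
    rw [g.lie_e_word_cons_self hv, LinearMap.sub_apply, ha]
  have hself₂ (w : List b.support) : ⁅g.e i₂, g.word v (i₂ :: w)⁆ =
      (c - wordWeight w (coroot i₂.1.1)) • g.word v w + ⁅g.f i₂, ⁅g.e i₂, g.word v w⁆⁆ := by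
    rw [g.lie_e_word_cons_self hv, LinearMap.sub_apply, hc]
  have hnil : wordWeight ([] : List b.support) = 0 := rfl
  have hf (i : b.support) (w : List b.support) : ⁅g.f i, g.word v w⁆ = g.word v (i :: w) := rfl
  have hfv (i : b.support) : ⁅g.f i, v⁆ = g.word v [i] := rfl
  refine ⟨⟨?_, ?_, ?_, ?_, ?_⟩, ?_, ?_, ?_, ?_, ?_, ?_⟩ <;>
    simp only [hself₁, hself₂, g.lie_e_word_cons_of_ne hne, g.lie_e_word_cons_of_ne hne.symm, he,
      lie_zero, lie_add, lie_smul, hf, hfv, word_nil, wordWeight_cons, hnil, LinearMap.add_apply,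
      LinearMap.zero_apply, h11, hp, hq]
  all_goals module

theorem finrank_weightSpace_sub_root [LieModule.IsIrreducible K L V]
    (hall : ∀ i : b.support, i = i₁ ∨ i = i₂) (hne : i₁ ≠ i₂) {v : V} (hv0 : v ≠ 0) {l : Dual K H}
    (hv : ∀ h : H, ⁅(h : L), v⁆ = l h • v) (he : ∀ i, ⁅g.e i, v⁆ = 0)
    (h₁ : l (coroot i₁.1.1) ≠ 0) :
    finrank K (weightSpace V (l - (rootSystem H).root i₁ : Dual K H)) = 1 := by
  classical
  have hw := g.weightSpace_eq_span_word hv0 hv he ((rootSystem H).root i₁)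
  have hset : {w : List b.support | wordWeight w = (rootSystem H).root i₁} = {[i₁]} := by
    rw [← List.setOf_count_eq_one_zero hall hne]
    ext w
    simpa using wordWeight_eq_iff hall hne w 1 0
  rw [hset, Set.image_singleton] at hw
  exact (congrArg (fun W : Submodule K V ↦ finrank K W) hw).trans
    (finrank_span_singleton (g.word_singleton_ne_zero hv0 hv he i₁ h₁))

/-- The independence of the two words is kept in the conclusion because the next level reuses it:
`e₁` maps the three words of weight `l - 2α₁ - α₂` into their span. -/
theorem finrank_weightSpace_sub_root_sub_root [LieModule.IsIrreducible K L V]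
    (hall : ∀ i : b.support, i = i₁ ∨ i = i₂) (hne : i₁ ≠ i₂) {v : V} (hv0 : v ≠ 0) {l : Dual K H}
    (hv : ∀ h : H, ⁅(h : L), v⁆ = l h • v) (he : ∀ i, ⁅g.e i, v⁆ = 0) {a c p q : ℕ}
    (ha : l (coroot i₁.1.1) = a) (hc : l (coroot i₂.1.1) = c)
    (hp : (rootSystem H).root i₂ (coroot i₁.1.1) = -(p : K))
    (hq : (rootSystem H).root i₁ (coroot i₂.1.1) = -(q : K))
    (ha1 : 1 ≤ a) (hc1 : 1 ≤ c) (hq1 : 1 ≤ q) :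
    LinearIndependent K ![g.word v [i₁, i₂], g.word v [i₂, i₁]] ∧
    finrank K (weightSpace V (l - ((rootSystem H).root i₁ + (rootSystem H).root i₂) :
      Dual K H)) = 2 := by
  classical
  obtain ⟨⟨t₁, t₂, t₃, t₄, -⟩, -⟩ := g.lie_e_word_table hne hv he ha hc hp hq
  have hx₁ := g.word_singleton_ne_zero hv0 hv he i₁
    (by rw [ha]; exact Nat.cast_ne_zero.2 (by omega))
  have hx₂ := g.word_singleton_ne_zero hv0 hv he i₂
    (by rw [hc]; exact Nat.cast_ne_zero.2 (by omega))
  have hind := linearIndependent_words_of_raising ha1 hq1 (toEnd K L V (g.e i₁))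
    (toEnd K L V (g.e i₂)) hx₁ hx₂ t₁ t₂ t₃ t₄
  refine ⟨hind, ?_⟩
  have hw := g.weightSpace_eq_span_word hv0 hv he
    ((rootSystem H).root i₁ + (rootSystem H).root i₂)
  have hset : {w : List b.support | wordWeight w =
      (rootSystem H).root i₁ + (rootSystem H).root i₂} = {[i₁, i₂], [i₂, i₁]} := by
    rw [← List.setOf_count_eq_one_one hall hne]
    ext w
    simpa using wordWeight_eq_iff hall hne w 1 1
  have hrange : Set.range ![g.word v [i₁, i₂], g.word v [i₂, i₁]] =
      {g.word v [i₁, i₂], g.word v [i₂, i₁]} := by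
    simp [Matrix.range_cons, Set.pair_comm]
  rw [hset, Set.image_pair, ← hrange] at hw
  exact (congrArg (fun W : Submodule K V ↦ finrank K W) hw).trans (finrank_span_eq_card hind)

theorem finrank_weightSpace_sub_two_root_sub_root [LieModule.IsIrreducible K L V]
    (hall : ∀ i : b.support, i = i₁ ∨ i = i₂) (hne : i₁ ≠ i₂) {v : V} (hv0 : v ≠ 0) {l : Dual K H}
    (hv : ∀ h : H, ⁅(h : L), v⁆ = l h • v) (he : ∀ i, ⁅g.e i, v⁆ = 0) {a c p q : ℕ}
    (ha : l (coroot i₁.1.1) = a) (hc : l (coroot i₂.1.1) = c)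
    (hp : (rootSystem H).root i₂ (coroot i₁.1.1) = -(p : K))
    (hq : (rootSystem H).root i₁ (coroot i₂.1.1) = -(q : K))
    (ha2 : 2 ≤ a) (hc1 : 1 ≤ c) (hp2 : 2 ≤ p) (hq1 : 1 ≤ q) :
    finrank K (weightSpace V (l - (2 • (rootSystem H).root i₁ + (rootSystem H).root i₂) :
      Dual K H)) = 3 := by
  classical
  obtain ⟨⟨-, -, -, -, t₀⟩, t₁, t₂, t₃, t₄, t₅, t₆⟩ := g.lie_e_word_table hne hv he ha hc hp hq
  obtain ⟨hind₂, -⟩ := g.finrank_weightSpace_sub_root_sub_root hall hne hv0 hv he ha hc hp hq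
    (by omega) hc1 hq1
  have hx₁ := g.word_singleton_ne_zero hv0 hv he i₁
    (by rw [ha]; exact Nat.cast_ne_zero.2 (by omega))
  -- Applying `e₁` gives `2(a - 1)f₁v`, which is nonzero because `a ≥ 2`.
  have hx₁₁ : g.word v [i₁, i₁] ≠ 0 := by
    intro h
    rw [h, lie_zero, eq_comm, smul_eq_zero] at t₀
    have ht : ((2 * (a - 1) : ℕ) : K) = 0 := by
      rw [← t₀.resolve_right hx₁]
      push_cast [Nat.cast_sub (show 1 ≤ a by omega)]
      ring
    rw [Nat.cast_eq_zero] at ht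
    omega
  have hind := linearIndependent_words_of_raising' ha2 hp2 hq1 (toEnd K L V (g.e i₁))
    (toEnd K L V (g.e i₂)) hx₁₁ hind₂ t₁ t₂ t₃ t₄ t₅ t₆
  have hw := g.weightSpace_eq_span_word hv0 hv he
    (2 • (rootSystem H).root i₁ + (rootSystem H).root i₂)
  have hset : {w : List b.support | wordWeight w =
      2 • (rootSystem H).root i₁ + (rootSystem H).root i₂} =
        {[i₁, i₁, i₂], [i₁, i₂, i₁], [i₂, i₁, i₁]} := by
    rw [← List.setOf_count_eq_two_one hall hne]
    ext w
    simpa using wordWeight_eq_iff hall hne w 2 1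
  have hrange : Set.range
      ![g.word v [i₁, i₁, i₂], g.word v [i₁, i₂, i₁], g.word v [i₂, i₁, i₁]] =
      {g.word v [i₁, i₁, i₂], g.word v [i₁, i₂, i₁], g.word v [i₂, i₁, i₁]} := by
    rw [Matrix.range_cons, Matrix.range_cons, Matrix.range_cons, Matrix.range_empty,
      Set.union_empty, Set.singleton_union, Set.singleton_union]
  rw [hset, Set.image_insert_eq, Set.image_pair, ← hrange] at hw
  exact (congrArg (fun W : Submodule K V ↦ finrank K W) hw).trans (finrank_span_eq_card hind)

end RankTwoMultiplicities

end LieAlgebra.IsKilling.SimpleGenerators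

/-! ### The multiplicities for `𝔰𝔬₅` -/

open LieAlgebra.IsKilling in
theorem fundamentalWeight_apply_coroot {M : Matrix (Fin 5) (Fin 5) ℂ} [IsNondegenerateSymmetric M]
    {H : LieSubalgebra ℂ (so5 M)} [H.IsCartanSubalgebra] (b : (rootSystem H).Base)
    [DecidableEq b.support] (i j : b.support) :
    fundamentalWeight b i (coroot j.1.1) = if j = i then 1 else 0 := by
  have h : coroot j.1.1 = b.toCoweightBasis j := (b.toCoweightBasis_apply j).symm
  rw [fundamentalWeight, h, Module.Basis.coord_apply, Module.Basis.repr_self,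
    Finsupp.single_apply]

theorem corollary2 (M : Matrix (Fin 5) (Fin 5) ℂ) [IsNondegenerateSymmetric M]
    (H : LieSubalgebra ℂ (so5 M)) [H.IsCartanSubalgebra]
    (b : (LieAlgebra.IsKilling.rootSystem H).Base)
    (i₁ i₂ : b.support) (hall : ∀ i : b.support, i = i₁ ∨ i = i₂)
    (hlong : rootSqLength (i₁ : H.root) < rootSqLength (i₂ : H.root))
    (l₁ l₂ : ℕ) (l : Module.Dual ℂ H)
    (hl : l = l₁ • fundamentalWeight b i₁ + l₂ • fundamentalWeight b i₂)
    (V : Type*) [AddCommGroup V] [Module ℂ V] [LieRingModule (so5 M) V] [LieModule ℂ (so5 M) V]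
    (hV : IsIrreducibleOfHighestWeight b V l) :
    (1 ≤ l₁ → weightMultiplicity V (l - simpleRoot b i₁) = 1) ∧
    (1 ≤ l₂ → weightMultiplicity V (l - simpleRoot b i₂) = 1) ∧
    (1 ≤ l₁ → 1 ≤ l₂ → weightMultiplicity V (l - simpleRoot b i₁ - simpleRoot b i₂) = 2) ∧
    (2 ≤ l₁ → 1 ≤ l₂ →
      weightMultiplicity V (l - (2 : ℕ) • simpleRoot b i₁ - simpleRoot b i₂) = 3) := by
  classical
  have hne : i₁ ≠ i₂ := by
    rintro rfl
    exact lt_irrefl _ hlong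
  obtain ⟨p, q, hp2, hq1, hp, hq⟩ := LieAlgebra.IsKilling.exists_root_coroot_eq_neg hall hlong
  obtain ⟨g⟩ := LieAlgebra.IsKilling.nonempty_simpleGenerators b
  obtain ⟨hirr, v, hv0, hvl, hpos⟩ := hV
  have hv : ∀ h : H, ⁅(h : so5 M), v⁆ = l h • v := (LieModule.mem_weightSpace _ _).1 hvl
  have he (i : b.support) : ⁅g.e i, v⁆ = 0 :=
    hpos i.1 (b.isPos_of_mem_support i.2) _ (g.e_mem i)
  have ha : l (LieAlgebra.IsKilling.coroot i₁.1.1) = l₁ := by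
    simp [hl, fundamentalWeight_apply_coroot, hne]
  have hc : l (LieAlgebra.IsKilling.coroot i₂.1.1) = l₂ := by
    simp [hl, fundamentalWeight_apply_coroot, hne.symm]
  refine ⟨fun h₁ ↦ ?_, fun h₂ ↦ ?_, fun h₁ h₂ ↦ ?_, fun h₁ h₂ ↦ ?_⟩
  · exact g.finrank_weightSpace_sub_root hall hne hv0 hv he
      (by rw [ha]; exact Nat.cast_ne_zero.2 (by omega))
  -- The multiplicity one statement does not involve root lengths, so the two simple roots may be
  -- exchanged.
  · exact g.finrank_weightSpace_sub_root (fun i ↦ (hall i).symm) hne.symm hv0 hv he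
      (by rw [hc]; exact Nat.cast_ne_zero.2 (by omega))
  · rw [sub_sub]
    exact (g.finrank_weightSpace_sub_root_sub_root hall hne hv0 hv he ha hc hp hq h₁ h₂ hq1).2
  · rw [sub_sub]
    exact g.finrank_weightSpace_sub_two_root_sub_root hall hne hv0 hv he ha hc hp hq h₁ h₂ hp2 hq1
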